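/- Let $d\ge 3$ be a fixed integer and $\alpha>0$. Let $A$ be the adjacency matrix of a uniformly random simple $d$-regular graph on $[n]=\{1,\dots,n\}$, and let $W=(W_{ij})_{i,j\in[n]}$ be a real symmetric random matrix whose entries $W_{ij}$, $i<j$, are i.i.d. and independent of $A$, with, for some constants $C_1,C_2>0$ and all $t\ge 1$, $$\tfrac{C_1}{2}e^{-t^\alpha}\le \mathbb P(W_{ij}\ge t)\le \tfrac{C_2}{2}e^{-t^\alpha},\qquad \tfrac{C_1}{2}e^{-t^\alpha}\le \mathbb P(W_{ij}\le -t)\le \tfrac{C_2}{2}e^{-t^\alpha}.$$ Let $X=A\odot W$, i.e. $X_{ij}=A_{ij}W_{ij}$, and let $\lambda_1(X)$ be its largest eigenvalue. For an integer $L\ge 1$ let $\mathbb T_d^{(L)}$ be the $d$-regular tree of depth $L$ (a rooted tree in which every non-leaf vertex has degree $d$ and every leaf is at distance $L$ from the root), and for $\gamma>0$ let $$K_d^{(L)}(\gamma)=\sup\Big\{\Big(\sum_{(i,j)} u_i^\gamma u_j^\gamma\Big)^{\frac1{2\gamma}} : u_i\ge 0\ \text{for all } i\in V(\mathbb T_d^{(L)}),\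 \sum_{i} u_i=1\Big\},$$ where the inner sum is over all ordered pairs $(i,j)$ of adjacent vertices of $\mathbb T_d^{(L)}$. Below, $n\to\infty$ through the integers with $nd$ even. 1. Let $\alpha>1$ and $\frac1\alpha+\frac1\beta=1$. There is $\delta_0=\delta_0(\alpha)\in(0,1]$ such that for every $\delta\in(0,\delta_0)$ and every integer $L\ge1$, $$\mathbb P\big(\lambda_1(X)\le (1-\delta)\,2^{1/\alpha}K_d^{(L)}(\beta/2)(\log n)^{1/\alpha}\big)\le \exp\big(-n^{1-(1-\delta)^\alpha+o(1)}\big),$$ for all sufficiently large $n$. 2. Let $0<\alpha\le 1$. For every $\delta\in(0,1)$, $$\mathbb P\big(\lambda_1(X)\le (1-\delta)(\log n)^{1/\alpha}\big)\le \exp\big(-n^{1-(1-\delta)^\alpha+o(1)}\big),$$ for all sufficiently large $n$. Here $o(1)$ is a sequence tending to $0$ as $n\to\infty$ that, together with the threshold for $n$, depends only on $\alpha,\delta,d,C_1,C_2$ (and $L$ in part 1). -/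

import Mathlib

open MeasureTheory ProbabilityTheory Filter Topology
open scoped Matrix

noncomputable section

/-- `ν` is a Weibull law with shape parameter `α` and tail constants `C₁`, `C₂`: both tails at
level `t ≥ 1` lie between `C₁ exp (-t ^ α) / 2` and `C₂ exp (-t ^ α) / 2`. -/
structure IsWeibull (α C₁ C₂ : ℝ) (ν : Measure ℝ) : Prop where
  isProb : IsProbabilityMeasure ν
  pos₁ : 0 < C₁
  pos₂ : 0 < C₂
  right_lower : ∀ t : ℝ, 1 ≤ t → C₁ * Real.exp (-t ^ α) / 2 ≤ ν.real (Set.Ici t)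
  right_upper : ∀ t : ℝ, 1 ≤ t → ν.real (Set.Ici t) ≤ C₂ * Real.exp (-t ^ α) / 2
  left_lower : ∀ t : ℝ, 1 ≤ t → C₁ * Real.exp (-t ^ α) / 2 ≤ ν.real (Set.Iic (-t))
  left_upper : ∀ t : ℝ, 1 ≤ t → ν.real (Set.Iic (-t)) ≤ C₂ * Real.exp (-t ^ α) / 2

open Classical in
/-- The (finite) set of simple `d`-regular graphs with vertex set `Fin n`. -/
def regularGraphs (n d : ℕ) : Set (SimpleGraph (Fin n)) :=
  {G | G.IsRegularOfDegree d}

/-- The weighted random `d`-regular graph: `A` is a uniformly random `d`-regular graph on `Fin n`,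
`W` is a symmetric random matrix whose entries above the diagonal are i.i.d. Weibull variables, and
these entries are (jointly) independent of `A`. The diagonal of `W` is unconstrained, since it does
not enter the matrix `A ⊙ W`. -/
structure IsWeightedRegularGraph {Ω : Type*} [MeasurableSpace Ω] (μ : Measure Ω)
    (n d : ℕ) (α C₁ C₂ : ℝ) (A : Ω → SimpleGraph (Fin n))
    (W : Ω → Matrix (Fin n) (Fin n) ℝ) : Prop where
  graph_law : HasLaw A (uniformOn (regularGraphs n d)) μ
  symm : ∀ ω, (W ω).IsSymm
  weight_law : ∃ ν : Measure ℝ, IsWeibull α C₁ C₂ ν ∧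
    ∀ i j : Fin n, i < j → HasLaw (fun ω => W ω i j) ν μ
  weight_indep : iIndepFun
    (fun (e : {e : Fin n × Fin n // e.1 < e.2}) (ω : Ω) => W ω e.1.1 e.1.2) μ
  graph_indep : IndepFun A
    (fun (ω : Ω) (e : {e : Fin n × Fin n // e.1 < e.2}) => W ω e.1.1 e.1.2) μ

open Classical in
/-- The weighted adjacency matrix `X = A ⊙ W` (entrywise product). -/
def weightedAdj {n : ℕ} (G : SimpleGraph (Fin n)) (W : Matrix (Fin n) (Fin n) ℝ) :
    Matrix (Fin n) (Fin n) ℝ :=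
  G.adjMatrix ℝ ⊙ W

/-- The largest eigenvalue of a real square matrix (used for symmetric matrices with `0 < n`,
where the spectrum is a nonempty finite set of reals). -/
def largestEigenvalue {n : ℕ} (M : Matrix (Fin n) (Fin n) ℝ) : ℝ :=
  sSup (spectrum ℝ M)

/-- The vertices of the `d`-regular tree of depth `L`: words of length at most `L` over `Fin d`
without two equal consecutive letters. The empty word is the root. -/
def TreeVertex (d L : ℕ) : Type :=
  {w : List (Fin d) // w.length ≤ L ∧ w.IsChain (· ≠ ·)}

instance (d L : ℕ) : Finite (TreeVertex d L) :=
  Set.Finite.to_subtype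
    ((List.finite_length_le (Fin d) L).subset
      (fun _ hw => hw.1) : {w : List (Fin d) | w.length ≤ L ∧ w.IsChain (· ≠ ·)}.Finite)

instance (d L : ℕ) : Fintype (TreeVertex d L) := Fintype.ofFinite _

/-- The `d`-regular tree of depth `L`: two words are adjacent when one arises from the other by
putting one letter in front of it. The root has `d` children, every other word of length less than
`L` has `d - 1` children and one parent, and the words of length `L` are the leaves. -/
def regularTree (d L : ℕ) : SimpleGraph (TreeVertex d L) where
  Adj u v := ∃ a : Fin d, u.1 = a :: v.1 ∨ v.1 = a :: u.1
  symm := ⟨fun _ _ ⟨a, h⟩ => ⟨a, h.symm⟩⟩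
  loopless := ⟨fun u ⟨a, h⟩ => by rcases h with h | h <;> simpa using congrArg List.length h⟩

open Classical in
/-- The sum of `u i ^ γ * u j ^ γ` over the directed edges `(i, j)` of the graph `G`. -/
def edgeEnergy {V : Type*} [Fintype V] (G : SimpleGraph V) (γ : ℝ) (u : V → ℝ) : ℝ :=
  ∑ i, ∑ j, if G.Adj i j then u i ^ γ * u j ^ γ else 0

/-- The constant `K_d^{(L)}(γ)`: the supremum of `(∑ u i ^ γ * u j ^ γ) ^ (1 / (2 * γ))`, the sum
being over the directed edges of the `d`-regular tree of depth `L`, over all nonnegative vectors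
`u` with `∑ u i = 1`. -/
def treeConst (d L : ℕ) (γ : ℝ) : ℝ :=
  sSup {x : ℝ | ∃ u : TreeVertex d L → ℝ, (∀ i, 0 ≤ u i) ∧ ∑ i, u i = 1 ∧
    x = edgeEnergy (regularTree d L) γ u ^ (1 / (2 * γ))}

end

/-!
The lower tail is governed by a deterministic statement about every `d`-regular graph; nothing about
typical random regular graphs is needed.

Spend a budget `B` on the edges of a graph by asking `W i j ≥ t i j`, where `∑ t i j ^ α = B`, the
sum being over undirected edges. Testing the matrix with the square root of a probability vector `u`
and choosing `t` by the equality case of Hölder's inequality forces `λ₁ ≥ 2 ^ (1 / α) * E ^ (1 / β)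
* B ^ (1 / α)`, where `E` is the energy of `u` with exponent `β / 2` (`exists_thresholds`). A
near-optimal `u` for the tree is carried into a ball of an arbitrary regular graph by the universal
covering (`exists_regularTree_cover`), and this does not decrease the energy
(`edgeEnergy_le_edgeEnergy_pushforward`): over each edge the lifts form a matching, and `2 * (β / 2)
≥ 1`. So short cycles only help, and every ball of radius `L` offers the value `2 ^ (1 / α) * K * B
^ (1 / α)` up to an arbitrarily small loss. For `α ≤ 1` a single edge with a large weight already
suffices.

By the lower bound on the tails, a given ball meets its thresholds with probability at least a
constant times `exp (-B)`, which is `n ^ (-s)` when `B = s * log n`. A regular graph contains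
linearly many disjoint balls (`exists_pairwiseDisjoint_walkBall`), in which these events are
independent, so all of them fail with probability at most `exp (-c * n ^ (1 - s))`
(`prob_largestEigenvalue_le`). Any `s > (1 - δ) ^ α` is admissible, and a diagonal choice of `s`
gives the error term in the exponent (`exists_tendsto_zero_of_forall_eventually`).
-/

/-! ### Analytic preliminaries -/

lemma sum_rpow_le_rpow_sum {ι : Type*} (s : Finset ι) {f : ι → ℝ} (hf : ∀ i ∈ s, 0 ≤ f i)
    {p : ℝ} (hp : 1 ≤ p) : ∑ i ∈ s, f i ^ p ≤ (∑ i ∈ s, f i) ^ p := by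
  classical
  induction s using Finset.induction_on with
  | empty => simp [Real.zero_rpow (by linarith : p ≠ 0)]
  | insert a s ha ih =>
    rw [Finset.sum_insert ha, Finset.sum_insert ha]
    have h0 : ∀ i ∈ s, 0 ≤ f i := fun i hi => hf i (Finset.mem_insert_of_mem hi)
    calc f a ^ p + ∑ i ∈ s, f i ^ p ≤ f a ^ p + (∑ i ∈ s, f i) ^ p := by gcongr; exact ih h0
      _ ≤ _ := Real.add_rpow_le_rpow_add (hf a (Finset.mem_insert_self _ _))
          (Finset.sum_nonneg h0) hp

/-- A property that holds eventually for each fixed `-η < 0` holds eventually along a sequence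
tending to zero, by a diagonal argument. -/
lemma exists_tendsto_zero_of_forall_eventually {P : ℕ → ℝ → Prop}
    (h : ∀ η : ℝ, 0 < η → ∀ᶠ n in atTop, P n (-η)) :
    ∃ ε : ℕ → ℝ, Tendsto ε atTop (𝓝 0) ∧ ∀ᶠ n in atTop, P n (ε n) := by
  have h' : ∀ k : ℕ, ∃ N, ∀ n ≥ N, P n (-(1 / ((k : ℝ) + 1))) := fun k =>
    eventually_atTop.1 (h _ (by positivity))
  choose N hN using h'
  let K : ℕ → ℕ := fun n => Nat.findGreatest (fun k => N k ≤ n) n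
  have hK : Tendsto K atTop atTop := by
    refine tendsto_atTop.2 fun k => ?_
    filter_upwards [eventually_ge_atTop (max k (N k))] with n hn
    exact Nat.le_findGreatest ((le_max_left _ _).trans hn) ((le_max_right _ _).trans hn)
  refine ⟨fun n => -(1 / ((K n : ℝ) + 1)), by
    simpa using (tendsto_one_div_add_atTop_nhds_zero_nat (𝕜 := ℝ).comp hK).neg, ?_⟩
  filter_upwards [eventually_ge_atTop (N 0)] with n hn
  exact hN _ _ (Nat.findGreatest_spec (P := fun k => N k ≤ n) (Nat.zero_le n) hn)

lemma eventually_rpow_le_const_mul_rpow {c a b : ℝ} (hc : 0 < c) (hab : a < b) :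
    ∀ᶠ n : ℕ in atTop, (n : ℝ) ^ a ≤ c * (n : ℝ) ^ b := by
  have h := ((tendsto_rpow_atTop (sub_pos.2 hab)).comp
    tendsto_natCast_atTop_atTop).eventually_ge_atTop (1 / c)
  filter_upwards [h, eventually_gt_atTop 0] with n hn hn0
  have hn' : (0 : ℝ) < n := by exact_mod_cast hn0
  simp only [Function.comp] at hn
  rw [Real.rpow_sub hn', div_le_div_iff₀ hc (by positivity)] at hn
  linarith

/-- The Rayleigh quotient bounds the largest eigenvalue from below. -/
lemma sum_sum_mul_le_largestEigenvalue {n : ℕ} {M : Matrix (Fin n) (Fin n) ℝ}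
    (hM : M.IsSymm) {v : Fin n → ℝ} (hv : ∑ i, v i ^ 2 = 1) :
    ∑ i, ∑ j, M i j * (v i * v j) ≤ largestEigenvalue M := by
  have hH : M.IsHermitian := by
    rw [Matrix.IsHermitian, Matrix.conjTranspose_eq_transpose_of_trivial]; exact hM
  set T := Matrix.toEuclideanLin M with hT
  have hTs : T.IsSymmetric := Matrix.isSymmetric_toEuclideanLin_iff.2 hH
  set x : EuclideanSpace ℝ (Fin n) := WithLp.toLp 2 v
  have hx : ‖x‖ ^ 2 = 1 := by rw [EuclideanSpace.real_norm_sq_eq]; exact hv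
  have hsum : inner ℝ (T x) x = ∑ i, ∑ j, M i j * (v i * v j) := by
    rw [hT, Matrix.toLpLin_apply, PiLp.inner_apply]
    refine Finset.sum_congr rfl fun i _ => ?_
    simp only [Matrix.mulVec, dotProduct, x, RCLike.inner_apply, conj_trivial, Finset.mul_sum]
    exact Finset.sum_congr rfl fun j _ => by ring
  have hbdd : BddAbove (spectrum ℝ M) := (Matrix.finite_real_spectrum (A := M)).bddAbove
  have hexp : inner ℝ (T x) x =
      ∑ i, hH.eigenvalues i * (inner ℝ (hH.eigenvectorBasis i) x) ^ 2 := by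
    rw [← hH.eigenvectorBasis.sum_inner_mul_inner]
    refine Finset.sum_congr rfl fun i _ => ?_
    have : T (hH.eigenvectorBasis i) = hH.eigenvalues i • hH.eigenvectorBasis i := by
      rw [hT, Matrix.toLpLin_apply, hH.mulVec_eigenvectorBasis]; rfl
    rw [hTs, ← real_inner_comm, real_inner_comm, this, inner_smul_right, real_inner_comm x]
    ring
  rw [← hsum, hexp]
  calc _ ≤ ∑ i, largestEigenvalue M * (inner ℝ (hH.eigenvectorBasis i) x) ^ 2 := by
        refine Finset.sum_le_sum fun i _ => ?_
        gcongr
        exact le_csSup hbdd (hH.eigenvalues_mem_spectrum_real i)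
    _ = largestEigenvalue M := by
        rw [← Finset.mul_sum, hH.eigenvectorBasis.sum_sq_inner_right, hx, mul_one]

/-! ### Balls and packings in regular graphs -/

section Graph

open Classical in
/-- The vertices reached from `x` by walks of length at most `k`. -/
noncomputable def walkBall {V : Type*} [Fintype V] (G : SimpleGraph V) :
    ℕ → V → Finset V
  | 0, x => {x}
  | k + 1, x => (walkBall G k x).biUnion fun y => insert y (G.neighborFinset y)

variable {V : Type*} [Fintype V] {G : SimpleGraph V}

open Classical in
lemma mem_walkBall_self (k : ℕ) (x : V) : x ∈ walkBall G k x := by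
  induction k with
  | zero => simp [walkBall]
  | succ k ih => exact Finset.mem_biUnion.2 ⟨x, ih, Finset.mem_insert_self _ _⟩

lemma mem_walkBall_succ {k : ℕ} {x z : V} :
    z ∈ walkBall G (k + 1) x ↔ ∃ y ∈ walkBall G k x, z = y ∨ G.Adj y z := by
  simp [walkBall]

lemma mem_walkBall_succ' {k : ℕ} {x z : V} :
    z ∈ walkBall G (k + 1) x ↔ ∃ y, (y = x ∨ G.Adj x y) ∧ z ∈ walkBall G k y := by
  induction k generalizing z with
  | zero => simp [walkBall]
  | succ k ih =>
    rw [mem_walkBall_succ]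
    simp only [ih]
    constructor
    · rintro ⟨y, ⟨w, hw, hy⟩, hz⟩
      exact ⟨w, hw, mem_walkBall_succ.2 ⟨y, hy, hz⟩⟩
    · rintro ⟨w, hw, hz⟩
      obtain ⟨y, hy, hz⟩ := mem_walkBall_succ.1 hz
      exact ⟨y, ⟨w, hw, hy⟩, hz⟩

lemma mem_walkBall_comm {k : ℕ} {x z : V} : z ∈ walkBall G k x ↔ x ∈ walkBall G k z := by
  induction k generalizing x z with
  | zero => simp [walkBall, eq_comm]
  | succ k ih =>
    rw [mem_walkBall_succ, mem_walkBall_succ']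
    refine exists_congr fun y => ?_
    rw [ih, G.adj_comm, and_comm, eq_comm]

lemma walkBall_mono {k l : ℕ} (h : k ≤ l) (x : V) : walkBall G k x ⊆ walkBall G l x := by
  induction l, h using Nat.le_induction with
  | base => exact subset_rfl
  | succ l _ ih => exact fun z hz => mem_walkBall_succ.2 ⟨z, ih hz, Or.inl rfl⟩

open Classical in
lemma card_walkBall_le {d : ℕ} (hG : G.IsRegularOfDegree d) (k : ℕ) (x : V) :
    (walkBall G k x).card ≤ (d + 1) ^ k := by
  induction k with
  | zero => simp [walkBall]
  | succ k ih =>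
    refine (Finset.card_biUnion_le_card_mul _ _ (d + 1) fun y _ => ?_).trans ?_
    · refine (Finset.card_insert_le _ _).trans ?_
      rw [G.card_neighborFinset_eq_degree, hG y]
    · rw [pow_succ]; gcongr

open Classical in
/-- The centres of a maximal family of pairwise disjoint balls of a regular graph make up a
proportion of the vertices that depends only on the degree and the radius: the ball around any
other vertex meets one of them. -/
lemma exists_pairwiseDisjoint_walkBall {d : ℕ} (hG : G.IsRegularOfDegree d) (k : ℕ) :
    ∃ I : Finset V, (I : Set V).PairwiseDisjoint (walkBall G k) ∧
      Fintype.card V ≤ I.card * ((d + 1) ^ k * (d + 1) ^ k) := by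
  obtain ⟨I, hI⟩ := (Set.toFinite {I : Finset V | (I : Set V).PairwiseDisjoint
    (walkBall G k)}).exists_maximal ⟨∅, by simp⟩
  refine ⟨I, hI.prop, ?_⟩
  have hcov : (Finset.univ : Finset V) ⊆
      I.biUnion fun y => (walkBall G k y).biUnion (walkBall G k) := by
    intro x _
    by_contra hx
    simp only [Finset.mem_biUnion, not_exists, not_and] at hx
    have hxI : x ∉ I := fun h => hx x h x (mem_walkBall_self _ _) (mem_walkBall_self _ _)
    have hins : ((insert x I : Finset V) : Set V).PairwiseDisjoint (walkBall G k) := by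
      rw [Finset.coe_insert]
      refine hI.prop.insert fun y hy _ => Finset.disjoint_left.2 fun z hz hz' => ?_
      exact hx y hy z hz' (mem_walkBall_comm.1 hz)
    exact hxI (hI.le_of_ge hins (Finset.subset_insert _ _) (Finset.mem_insert_self _ _))
  calc Fintype.card V ≤ _ := Finset.card_le_card hcov
    _ ≤ _ := Finset.card_biUnion_le_card_mul _ _ _ fun y _ =>
      (Finset.card_biUnion_le_card_mul _ _ _ fun z _ => card_walkBall_le hG k z).trans
        (by gcongr; exact card_walkBall_le hG k y)

end Graph

/-! ### The universal covering of a regular graph -/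

section Cover

variable {V : Type*} [Fintype V] {G : SimpleGraph V}

open Classical in
lemma exists_neighbor_labelling {d : ℕ} (hG : G.IsRegularOfDegree d) (z : V) :
    ∃ σ : Fin d → V, Function.Injective σ ∧ (∀ b, G.Adj z (σ b)) ∧
      ∀ w, G.Adj z w → ∃ b, σ b = w := by
  have hcard : Fintype.card (Fin d) = Fintype.card (G.neighborSet z) := by
    rw [Fintype.card_fin, G.card_neighborSet_eq_degree, hG z]
  let e := Fintype.equivOfCardEq hcard
  refine ⟨fun b => e b, Subtype.val_injective.comp e.injective, fun b => (e b).2, fun w hw => ?_⟩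
  exact ⟨e.symm ⟨w, hw⟩, by simp⟩

open Classical in
lemma exists_neighbor_labelling_apply_eq {d : ℕ} (hG : G.IsRegularOfDegree d) {z w : V}
    (h : G.Adj z w) (a : Fin d) :
    ∃ σ : Fin d → V, Function.Injective σ ∧ (∀ b, G.Adj z (σ b)) ∧ σ a = w := by
  obtain ⟨σ, hσ, hadj, hsurj⟩ := exists_neighbor_labelling hG z
  obtain ⟨b, rfl⟩ := hsurj w h
  exact ⟨σ ∘ Equiv.swap a b, hσ.comp (Equiv.injective _), fun c => hadj _, by simp⟩

open Classical in
/-- The universal covering of a `d`-regular graph, restricted to a ball: the `d`-regular tree of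
depth `L` maps to the ball around any given vertex by a locally injective graph homomorphism. -/
lemma exists_regularTree_cover {d : ℕ} (hG : G.IsRegularOfDegree d) (L : ℕ) (x : V) :
    ∃ π : TreeVertex d L → V, (∀ w, π w ∈ walkBall G L x) ∧
      (∀ u v, (regularTree d L).Adj u v → G.Adj (π u) (π v)) ∧
      ∀ u v w, (regularTree d L).Adj u v → (regularTree d L).Adj u w → π v = π w → v = w := by
  have hσ : ∀ (z w : V) (a : Fin d), ∃ σ : Fin d → V, G.Adj z w →
      Function.Injective σ ∧ (∀ b, G.Adj z (σ b)) ∧ σ a = w := by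
    intro z w a
    by_cases h : G.Adj z w
    · obtain ⟨σ, hσ⟩ := exists_neighbor_labelling_apply_eq hG h a
      exact ⟨σ, fun _ => hσ⟩
    · exact ⟨fun _ => z, fun h' => absurd h' h⟩
  choose σ hσ using hσ
  obtain ⟨σ₀, hσ₀, hadj₀, -⟩ := exists_neighbor_labelling hG x
  -- The image of a word comes with a labelling of its neighbours in which the first letter of the
  -- word labels the image of its parent; the children then go to the other neighbours.
  let f : List (Fin d) → V × (Fin d → V) := fun w =>
    List.rec (x, σ₀) (fun a _ s => (s.2 a, σ (s.2 a) s.1 a)) w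
  have hf : ∀ a w, f (a :: w) = ((f w).2 a, σ ((f w).2 a) (f w).1 a) := fun _ _ => rfl
  have hlab : ∀ w, Function.Injective (f w).2 ∧ ∀ b, G.Adj (f w).1 ((f w).2 b) := by
    intro w
    induction w with
    | nil => exact ⟨hσ₀, hadj₀⟩
    | cons a w ih => exact ⟨(hσ _ _ a (ih.2 a).symm).1, (hσ _ _ a (ih.2 a).symm).2.1⟩
  have hpar : ∀ a w, (f (a :: w)).2 a = (f w).1 := fun a w =>
    (hσ _ _ a ((hlab w).2 a).symm).2.2
  have hball : ∀ w, (f w).1 ∈ walkBall G w.length x := by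
    intro w
    induction w with
    | nil => exact mem_walkBall_self 0 x
    | cons a w ih => exact mem_walkBall_succ.2 ⟨_, ih, Or.inr ((hlab w).2 a)⟩
  have hnbr : ∀ u v : TreeVertex d L, (regularTree d L).Adj u v →
      ∃ a, (f v.1).1 = (f u.1).2 a ∧ (v.1 = a :: u.1 ∨ u.1 = a :: v.1) := by
    rintro u v ⟨a, h | h⟩
    · exact ⟨a, by rw [h, hpar], Or.inr h⟩
    · exact ⟨a, by rw [h, hf], Or.inl h⟩
  refine ⟨fun w => (f w.1).1, fun w => walkBall_mono w.2.1 x (hball w.1), fun u v h => ?_,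
    fun u v w huv huw h => ?_⟩
  · obtain ⟨a, ha, -⟩ := hnbr u v h
    show G.Adj _ (f v.1).1
    rw [ha]
    exact (hlab u.1).2 a
  · obtain ⟨a, ha, hv⟩ := hnbr u v huv
    obtain ⟨b, hb, hw⟩ := hnbr u w huw
    obtain rfl : a = b := (hlab u.1).1 (by rw [← ha, ← hb]; exact h)
    -- A word cannot begin with the same letter twice.
    have hne : ∀ s t : TreeVertex d L, s.1 ≠ a :: a :: t.1 := fun s t hst => by
      have := s.2.2
      rw [hst] at this
      simp at this
    apply Subtype.ext
    rcases hv with hv | hv <;> rcases hw with hw | hw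
    · rw [hv, hw]
    · exact absurd (by rw [hv, hw]) (hne v w)
    · exact absurd (by rw [hw, hv]) (hne w v)
    · rw [hv] at hw
      exact (List.cons.inj hw).2

/-! ### Energies under pushforward -/

open Classical in
/-- The image of the mass distribution `u` under `π`: the mass at `z` is the sum of `u` over the
fibre above `z`. -/
noncomputable def massPushforward {T V : Type*} [Fintype T] (π : T → V) (u : T → ℝ) (z : V) : ℝ :=
  ∑ y with π y = z, u y

lemma massPushforward_nonneg {T V : Type*} [Fintype T] (π : T → V) {u : T → ℝ}
    (hu : ∀ i, 0 ≤ u i) (z : V) : 0 ≤ massPushforward π u z :=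
  Finset.sum_nonneg fun y _ => hu y

lemma sum_massPushforward {T V : Type*} [Fintype T] [Fintype V] (π : T → V) (u : T → ℝ) :
    ∑ z, massPushforward π u z = ∑ y, u y := by
  classical
  exact Finset.sum_fiberwise _ _ _

lemma massPushforward_eq_zero {T V : Type*} [Fintype T] {π : T → V} (u : T → ℝ) {z : V}
    (hz : ∀ y, π y ≠ z) : massPushforward π u z = 0 := by
  classical
  rw [massPushforward, Finset.filter_false_of_mem fun y _ => hz y, Finset.sum_empty]

open Classical in
lemma edgeEnergy_eq_sum_filter (G : SimpleGraph V) (γ : ℝ) (u : V → ℝ) :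
    edgeEnergy G γ u = ∑ p : V × V with G.Adj p.1 p.2, u p.1 ^ γ * u p.2 ^ γ := by
  rw [edgeEnergy, Finset.sum_filter, Fintype.sum_prod_type]

lemma edgeEnergy_nonneg (G : SimpleGraph V) (γ : ℝ) {u : V → ℝ} (hu : ∀ i, 0 ≤ u i) :
    0 ≤ edgeEnergy G γ u := by
  rw [edgeEnergy_eq_sum_filter]
  exact Finset.sum_nonneg fun p _ => mul_nonneg (Real.rpow_nonneg (hu _) _)
    (Real.rpow_nonneg (hu _) _)

open Classical in
/-- Pushing a mass distribution forward along a locally injective homomorphism does not decrease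
the energy. Over each edge the edges of the source form a matching, so that the inequality reduces
to Cauchy-Schwarz and the superadditivity of `x ↦ x ^ (2 * γ)`. -/
lemma edgeEnergy_le_edgeEnergy_pushforward {T : Type*} [Fintype T] {H : SimpleGraph T}
    {π : T → V} (hom : ∀ u v, H.Adj u v → G.Adj (π u) (π v))
    (inj : ∀ u v w, H.Adj u v → H.Adj u w → π v = π w → v = w) {γ : ℝ} (hγ : 1 / 2 ≤ γ)
    {u : T → ℝ} (hu : ∀ i, 0 ≤ u i) :
    edgeEnergy H γ u ≤ edgeEnergy G γ (massPushforward π u) := by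
  rw [edgeEnergy_eq_sum_filter, edgeEnergy_eq_sum_filter,
    ← Finset.sum_fiberwise_of_maps_to (g := fun p : T × T => (π p.1, π p.2))
      (t := Finset.univ.filter fun p : V × V => G.Adj p.1 p.2)
      (by intro p hp; simpa using hom _ _ (by simpa using hp))]
  refine Finset.sum_le_sum fun q _ => ?_
  set P := (Finset.univ.filter fun p : T × T => H.Adj p.1 p.2).filter
    fun p => (π p.1, π p.2) = q with hP
  have hmem : ∀ p ∈ P, H.Adj p.1 p.2 ∧ π p.1 = q.1 ∧ π p.2 = q.2 := by
    intro p hp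
    simp only [hP, Finset.mem_filter, Finset.mem_univ, true_and, Prod.ext_iff] at hp
    exact hp
  have h1 : ∑ p ∈ P, u p.1 ≤ massPushforward π u q.1 := by
    rw [← Finset.sum_image (f := u) (g := Prod.fst) (s := P)]
    · refine Finset.sum_le_sum_of_subset_of_nonneg (fun y hy => ?_) fun i _ _ => hu i
      obtain ⟨p, hp, rfl⟩ := Finset.mem_image.1 hy
      simpa using (hmem p hp).2.1
    · intro p hp p' hp' h
      obtain ⟨ha, -, h2⟩ := hmem p hp
      obtain ⟨ha', -, h2'⟩ := hmem p' hp'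
      refine Prod.ext h (inj p.1 _ _ ha ?_ (h2.trans h2'.symm))
      rw [show p.1 = p'.1 from h]; exact ha'
  have h2 : ∑ p ∈ P, u p.2 ≤ massPushforward π u q.2 := by
    rw [← Finset.sum_image (f := u) (g := Prod.snd) (s := P)]
    · refine Finset.sum_le_sum_of_subset_of_nonneg (fun y hy => ?_) fun i _ _ => hu i
      obtain ⟨p, hp, rfl⟩ := Finset.mem_image.1 hy
      simpa using (hmem p hp).2.2
    · intro p hp p' hp' h
      obtain ⟨ha, h2, -⟩ := hmem p hp
      obtain ⟨ha', h2', -⟩ := hmem p' hp'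
      refine Prod.ext (inj p.2 _ _ ha.symm ?_ (h2.trans h2'.symm)) h
      rw [show p.2 = p'.2 from h]; exact ha'.symm
  have hA : 0 ≤ ∑ p ∈ P, u p.1 := Finset.sum_nonneg fun _ _ => hu _
  have hB : 0 ≤ ∑ p ∈ P, u p.2 := Finset.sum_nonneg fun _ _ => hu _
  have hsqrt : ∀ a : ℝ, 0 ≤ a → √a ^ (2 * γ) = a ^ γ := fun a ha => by
    rw [Real.sqrt_eq_rpow, ← Real.rpow_mul ha]; congr 1; ring
  calc ∑ p ∈ P, u p.1 ^ γ * u p.2 ^ γ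
      = ∑ p ∈ P, (√(u p.1) * √(u p.2)) ^ (2 * γ) := by
        refine Finset.sum_congr rfl fun p _ => ?_
        rw [Real.mul_rpow (Real.sqrt_nonneg _) (Real.sqrt_nonneg _), hsqrt _ (hu _),
          hsqrt _ (hu _)]
    _ ≤ (∑ p ∈ P, √(u p.1) * √(u p.2)) ^ (2 * γ) :=
        sum_rpow_le_rpow_sum _ (fun p _ => by positivity) (by linarith)
    _ ≤ (√(∑ p ∈ P, u p.1) * √(∑ p ∈ P, u p.2)) ^ (2 * γ) := by
        refine Real.rpow_le_rpow (Finset.sum_nonneg fun _ _ => by positivity) ?_ (by linarith)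
        exact Real.sum_sqrt_mul_sqrt_le P (fun _ => hu _) fun _ => hu _
    _ = (∑ p ∈ P, u p.1) ^ γ * (∑ p ∈ P, u p.2) ^ γ := by
        rw [Real.mul_rpow (Real.sqrt_nonneg _) (Real.sqrt_nonneg _), hsqrt _ hA, hsqrt _ hB]
    _ ≤ _ := by
        have hγ0 : 0 ≤ γ := by linarith
        exact mul_le_mul (Real.rpow_le_rpow hA h1 hγ0) (Real.rpow_le_rpow hB h2 hγ0)
          (Real.rpow_nonneg hB _) (Real.rpow_nonneg (Finset.sum_nonneg fun _ _ => hu _) _)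

end Cover

/-! ### The tree constant -/

section TreeConst

/-- The supremum defining `treeConst` is a genuine one, not the default value of `sSup`. -/
lemma bddAbove_treeConst_set (d L : ℕ) {γ : ℝ} (hγ : 0 < γ) :
    BddAbove {x : ℝ | ∃ u : TreeVertex d L → ℝ, (∀ i, 0 ≤ u i) ∧ ∑ i, u i = 1 ∧
      x = edgeEnergy (regularTree d L) γ u ^ (1 / (2 * γ))} := by
  classical
  refine ⟨(∑ i : TreeVertex d L, ∑ j : TreeVertex d L, (1 : ℝ)) ^ (1 / (2 * γ)), ?_⟩
  rintro x ⟨u, hu, hsum, rfl⟩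
  refine Real.rpow_le_rpow (edgeEnergy_nonneg _ _ hu) ?_ (by positivity)
  have h1 : ∀ i, u i ^ γ ≤ 1 := fun i => Real.rpow_le_one (hu i)
    (hsum ▸ Finset.single_le_sum (fun j _ => hu j) (Finset.mem_univ i)) hγ.le
  unfold edgeEnergy
  refine Finset.sum_le_sum fun i _ => Finset.sum_le_sum fun j _ => ?_
  split_ifs
  · exact mul_le_one₀ (h1 i) (Real.rpow_nonneg (hu j) _) (h1 j)
  · exact zero_le_one

/-- The uniform distribution has positive energy as soon as the tree has an edge. -/
lemma treeConst_pos {d L : ℕ} (hd : 1 ≤ d) (hL : 1 ≤ L) {γ : ℝ} (hγ : 0 < γ) :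
    0 < treeConst d L γ := by
  classical
  let r : TreeVertex d L := ⟨[], by simp⟩
  let c : TreeVertex d L := ⟨[⟨0, hd⟩], by simpa using hL⟩
  have hN : 0 < (Fintype.card (TreeVertex d L) : ℝ) := by
    exact_mod_cast Fintype.card_pos_iff.2 ⟨r⟩
  set u : TreeVertex d L → ℝ := fun _ => 1 / (Fintype.card (TreeVertex d L) : ℝ)
  have hu : ∀ i, 0 < u i := fun i => by positivity
  have hE : 0 < edgeEnergy (regularTree d L) γ u := by
    rw [edgeEnergy_eq_sum_filter]
    refine Finset.sum_pos (fun p _ => mul_pos (Real.rpow_pos_of_pos (hu p.1) _)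
      (Real.rpow_pos_of_pos (hu p.2) _)) ⟨(r, c), ?_⟩
    exact Finset.mem_filter.2 ⟨Finset.mem_univ _, ⟨0, hd⟩, Or.inr rfl⟩
  refine (Real.rpow_pos_of_pos hE (1 / (2 * γ))).trans_le
    (le_csSup (bddAbove_treeConst_set d L hγ) ⟨u, fun i => (hu i).le, ?_, rfl⟩)
  simp only [u, Finset.sum_const, Finset.card_univ, nsmul_eq_mul]
  field_simp

lemma exists_lt_edgeEnergy_rpow {d L : ℕ} {γ b : ℝ} (hb : b < treeConst d L γ) :
    ∃ u : TreeVertex d L → ℝ, (∀ i, 0 ≤ u i) ∧ ∑ i, u i = 1 ∧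
      b < edgeEnergy (regularTree d L) γ u ^ (1 / (2 * γ)) := by
  classical
  let r : TreeVertex d L := ⟨[], by simp⟩
  have hne : {x : ℝ | ∃ u : TreeVertex d L → ℝ, (∀ i, 0 ≤ u i) ∧ ∑ i, u i = 1 ∧
      x = edgeEnergy (regularTree d L) γ u ^ (1 / (2 * γ))}.Nonempty :=
    ⟨_, Pi.single r 1, fun i => by by_cases h : i = r <;> simp [h], by simp, rfl⟩
  obtain ⟨x, ⟨u, hu, hsum, rfl⟩, hx⟩ := exists_lt_of_lt_csSup hne hb
  exact ⟨u, hu, hsum, hx⟩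

end TreeConst

/-! ### Thresholds that force a large eigenvalue -/

section Thresholds

/-- The position of an entry above the diagonal of an `n × n` matrix, which is also a potential
edge of a graph on `Fin n`. -/
abbrev UpperPair (n : ℕ) : Type := {e : Fin n × Fin n // e.1 < e.2}

variable {n : ℕ} {G : SimpleGraph (Fin n)} {W : Matrix (Fin n) (Fin n) ℝ}

open Classical in
lemma weightedAdj_apply (G : SimpleGraph (Fin n)) (W : Matrix (Fin n) (Fin n) ℝ) (i j : Fin n) :
    weightedAdj G W i j = if G.Adj i j then W i j else 0 := by
  simp [weightedAdj, Matrix.hadamard_apply, SimpleGraph.adjMatrix_apply]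

lemma isSymm_weightedAdj (hW : W.IsSymm) : (weightedAdj G W).IsSymm := by
  ext i j
  rw [Matrix.transpose_apply, weightedAdj_apply, weightedAdj_apply, G.adj_comm, hW.apply]

lemma le_largestEigenvalue_of_adj (hW : W.IsSymm) {i j : Fin n} (h : G.Adj i j) :
    W i j ≤ largestEigenvalue (weightedAdj G W) := by
  classical
  have hs : (1 / √2 : ℝ) * (1 / √2) = 1 / 2 := by
    rw [div_mul_div_comm, Real.mul_self_sqrt zero_le_two, one_mul]
  set v : Fin n → ℝ := Pi.single i (1 / √2) + Pi.single j (1 / √2) with hv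
  have hne := h.ne
  have hv1 : ∑ k, v k ^ 2 = 1 := by
    have : ∑ k, v k ^ 2 = v ⬝ᵥ v := Finset.sum_congr rfl fun k _ => sq _
    rw [this, hv]
    simp only [add_dotProduct, single_dotProduct, Pi.add_apply, Pi.single_eq_same,
      Pi.single_eq_of_ne hne, Pi.single_eq_of_ne hne.symm]
    linarith
  refine le_of_eq_of_le ?_ (sum_sum_mul_le_largestEigenvalue (isSymm_weightedAdj hW) hv1)
  have : ∑ a, ∑ b, weightedAdj G W a b * (v a * v b) = v ⬝ᵥ weightedAdj G W *ᵥ v := by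
    simp only [dotProduct, Matrix.mulVec, Finset.mul_sum]
    exact Finset.sum_congr rfl fun a _ => Finset.sum_congr rfl fun b _ => by ring
  rw [this, hv]
  simp only [add_dotProduct, single_dotProduct, Matrix.mulVec_add, Pi.add_apply,
    Matrix.mulVec_single, Matrix.col_apply, Pi.smul_apply, MulOpposite.smul_eq_mul_unop,
    MulOpposite.unop_op, weightedAdj_apply, h, h.symm, SimpleGraph.irrefl, if_true, if_false,
    hW.apply i j]
  linear_combination (-2 * W i j) * hs

lemma two_mul_sum_upperPair {f : Fin n → Fin n → ℝ} (hf : ∀ i j, f i j = f j i)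
    (h0 : ∀ i, f i i = 0) :
    2 * ∑ e : UpperPair n, f e.1.1 e.1.2 = ∑ i, ∑ j, f i j := by
  have hup : ∑ p : Fin n × Fin n with p.1 < p.2, f p.1 p.2 = ∑ e : UpperPair n, f e.1.1 e.1.2 :=
    Finset.sum_subtype _ (by simp) _
  have hlow : ∑ p : Fin n × Fin n with ¬ p.1 < p.2, f p.1 p.2 =
      ∑ e : UpperPair n, f e.1.1 e.1.2 := by
    rw [← hup]
    calc ∑ p : Fin n × Fin n with ¬ p.1 < p.2, f p.1 p.2
        = ∑ p : Fin n × Fin n with p.2 < p.1, f p.1 p.2 := by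
          refine (Finset.sum_subset (fun p hp => ?_) fun p hp hp' => ?_).symm
          · simp only [Finset.mem_filter, Finset.mem_univ, true_and] at hp ⊢
            exact hp.not_gt
          · simp only [Finset.mem_filter, Finset.mem_univ, true_and] at hp hp'
            rw [le_antisymm (not_lt.1 hp') (not_lt.1 hp), h0]
      _ = _ := Finset.sum_nbij' Prod.swap Prod.swap (by simp) (by simp) (by simp) (by simp)
          fun p _ => hf _ _
  rw [← Fintype.sum_prod_type', ← Finset.sum_filter_add_sum_filter_not
    (Finset.univ : Finset (Fin n × Fin n)) (fun p => p.1 < p.2), hup, hlow, two_mul]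

/-- **Optimal thresholds.** For a probability vector `u` on the vertices, the vector `√u` tests the
matrix, and thresholds on the edges proportional to `(u i * u j) ^ ((β - 1) / 2)` are the equality
case of Hölder's inequality: their total cost `∑ t ^ α` is at most `B` and they force the largest eigenvalue
to be at least `2 ^ (1 / α) * E ^ (1 / β) * B ^ (1 / α)`, where `E` is the energy of `u`. -/
lemma exists_thresholds (G : SimpleGraph (Fin n)) {α β : ℝ} (hα : 1 < α)
    (hαβ : 1 / α + 1 / β = 1) {B : ℝ} (hB : 0 < B) {u : Fin n → ℝ} (hu : ∀ i, 0 ≤ u i)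
    (hsum : ∑ i, u i = 1) {R : Finset (Fin n)} (hR : ∀ i ∉ R, u i = 0)
    (hE : 0 < edgeEnergy G (β / 2) u) :
    ∃ (S : Finset (UpperPair n)) (t : UpperPair n → ℝ), (∀ e ∈ S, e.1.1 ∈ R) ∧
      S.card ≤ R.card ^ 2 ∧ (∀ e ∈ S, 0 ≤ t e) ∧ ∑ e ∈ S, t e ^ α ≤ B ∧
      ∀ W : Matrix (Fin n) (Fin n) ℝ, W.IsSymm → (∀ e ∈ S, t e ≤ W e.1.1 e.1.2) →
        2 ^ (1 / α) * edgeEnergy G (β / 2) u ^ (1 / β) * B ^ (1 / α) ≤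
          largestEigenvalue (weightedAdj G W) := by
  classical
  set E := edgeEnergy G (β / 2) u with hEdef
  have hα0 : 0 < α := by linarith
  have hβinv : 1 / β = 1 - 1 / α := by linarith
  have hβ1 : 1 < β := (Real.holderConjugate_iff.2 ⟨hα, by simpa using hαβ⟩).symm.lt
  have hβ0 : 0 < β := by linarith
  have hmul : (β - 1) * α = β := by
    field_simp at hαβ
    linarith
  set c : ℝ := (2 * B / E) ^ (1 / α) with hc
  have hc0 : 0 ≤ c := by positivity
  have hcα : c ^ α = 2 * B / E := by
    rw [hc, ← Real.rpow_mul (by positivity), one_div_mul_cancel hα0.ne', Real.rpow_one]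
  set τ : Fin n → Fin n → ℝ := fun i j => (u i * u j) ^ ((β - 1) / 2) * c with hτ
  have huu : ∀ i j, 0 ≤ u i * u j := fun i j => mul_nonneg (hu i) (hu j)
  have hτ0 : ∀ i j, 0 ≤ τ i j := fun i j => mul_nonneg (Real.rpow_nonneg (huu i j) _) hc0
  have hτα : ∀ i j, τ i j ^ α = u i ^ (β / 2) * u j ^ (β / 2) * (2 * B / E) := fun i j => by
    rw [hτ, Real.mul_rpow (Real.rpow_nonneg (huu i j) _) hc0, hcα, ← Real.rpow_mul (huu i j),
      ← Real.mul_rpow (hu i) (hu j)]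
    congr 2; linarith
  have hττ : ∀ i j, τ i j * (√(u i) * √(u j)) = u i ^ (β / 2) * u j ^ (β / 2) * c := fun i j => by
    rw [hτ, ← Real.sqrt_mul (hu i), Real.sqrt_eq_rpow, mul_right_comm,
      ← Real.rpow_add_of_nonneg (huu i j) (by linarith) (by norm_num),
      ← Real.mul_rpow (hu i) (hu j)]
    congr 2; ring
  set S : Finset (UpperPair n) := Finset.univ.filter fun e =>
    G.Adj e.1.1 e.1.2 ∧ e.1.1 ∈ R ∧ e.1.2 ∈ R with hS
  refine ⟨S, fun e => τ e.1.1 e.1.2, fun e he => ?_, ?_, fun e _ => hτ0 _ _, ?_,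
    fun W hW hWt => ?_⟩
  · exact ((Finset.mem_filter.1 he).2).2.1
  · rw [sq, ← Finset.card_product]
    refine Finset.card_le_card_of_injOn Subtype.val (fun e he => ?_) Subtype.val_injective.injOn
    exact Finset.mem_coe.2 (Finset.mem_product.2 ((Finset.mem_filter.1 he).2).2)
  · have key := two_mul_sum_upperPair
      (f := fun i j => if G.Adj i j then u i ^ (β / 2) * u j ^ (β / 2) else 0)
      (fun i j => by simp only [G.adj_comm i j, mul_comm]) (fun i => by simp)
    change _ = E at key
    calc ∑ e ∈ S, τ e.1.1 e.1.2 ^ α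
        = ∑ e ∈ S, (if G.Adj e.1.1 e.1.2 then u e.1.1 ^ (β / 2) * u e.1.2 ^ (β / 2) else 0) *
            (2 * B / E) := by
          refine Finset.sum_congr rfl fun e he => ?_
          rw [hτα, if_pos ((Finset.mem_filter.1 he).2).1]
      _ ≤ ∑ e : UpperPair n, (if G.Adj e.1.1 e.1.2 then
            u e.1.1 ^ (β / 2) * u e.1.2 ^ (β / 2) else 0) * (2 * B / E) := by
          refine Finset.sum_le_sum_of_subset_of_nonneg (Finset.subset_univ _) fun e _ _ => ?_
          have := hu e.1.1
          have := hu e.1.2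
          split_ifs <;> positivity
      _ = B := by
          rw [← Finset.sum_mul]
          field_simp
          linarith
  · have hv : ∑ i, √(u i) ^ 2 = 1 := by
      rw [← hsum]; exact Finset.sum_congr rfl fun i _ => Real.sq_sqrt (hu i)
    refine le_trans ?_ (sum_sum_mul_le_largestEigenvalue (isSymm_weightedAdj hW) hv)
    have hEc : 2 ^ (1 / α) * E ^ (1 / β) * B ^ (1 / α) = E * c := by
      rw [hc, hβinv, Real.rpow_sub hE, Real.rpow_one, Real.div_rpow (by positivity) hE.le,
        Real.mul_rpow zero_le_two hB.le]
      ring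
    rw [hEc, hEdef, edgeEnergy, Finset.sum_mul]
    refine Finset.sum_le_sum fun i _ => ?_
    rw [Finset.sum_mul]
    refine Finset.sum_le_sum fun j _ => ?_
    rw [weightedAdj_apply]
    split_ifs with hadj
    · rw [← hττ]
      by_cases hij : i ∈ R ∧ j ∈ R
      · refine mul_le_mul_of_nonneg_right ?_ (by positivity)
        rcases lt_or_gt_of_ne hadj.ne with hlt | hlt
        · exact hWt ⟨(i, j), hlt⟩ (Finset.mem_filter.2 ⟨Finset.mem_univ _, hadj, hij⟩)
        · rw [← hW.apply i j, show τ i j = τ j i by simp only [hτ, mul_comm]]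
          exact hWt ⟨(j, i), hlt⟩ (Finset.mem_filter.2 ⟨Finset.mem_univ _, hadj.symm, hij.symm⟩)
      · have hz : √(u i) * √(u j) = 0 := by
          rcases not_and_or.1 hij with h | h <;> simp [hR _ h]
        rw [hz, mul_zero, mul_zero]
    · simp

end Thresholds

/-! ### Independent families and conditioning on the graph -/

section Probability

/-- If the groups of coordinates `E k` are disjoint, then the events that some coordinate of a group
misses its threshold are independent, one for each group. -/
lemma iIndepFun.measureReal_forall_exists_lt_le {Ω ι κ : Type*} [MeasurableSpace Ω]
    {μ : Measure Ω} [IsProbabilityMeasure μ] {X : ι → Ω → ℝ} (hX : iIndepFun X μ)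
    (hm : ∀ i, AEMeasurable (X i) μ) {E : κ → Finset ι} {t : κ → ι → ℝ} {p : ℝ}
    (I : Finset κ) (hdisj : (I : Set κ).PairwiseDisjoint E)
    (hp : ∀ k ∈ I, p ≤ ∏ e ∈ E k, μ.real {ω | t k e ≤ X e ω}) :
    μ.real {ω | ∀ k ∈ I, ∃ e ∈ E k, X e ω < t k e} ≤ (1 - p) ^ I.card := by
  classical
  induction I using Finset.induction_on with
  | empty => simp
  | insert a I ha ih =>
    rw [Finset.coe_insert] at hdisj
    have hih := ih (hdisj.subset (Set.subset_insert _ _))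
      fun k hk => hp k (Finset.mem_insert_of_mem hk)
    set T := I.biUnion E with hT
    have hST : Disjoint (E a) T := by
      rw [hT, Finset.disjoint_biUnion_right]
      exact fun k hk => hdisj (Set.mem_insert _ _) (Set.mem_insert_of_mem _ hk)
        (by rintro rfl; exact ha hk)
    have hind := hX.indepFun_finset₀ (E a) T hST hm
    set U : Set (E a → ℝ) := ⋃ e : E a, {w | w e < t a e} with hU
    set V : Set (T → ℝ) := ⋂ k ∈ I, ⋃ e : T, ⋃ _ : e.1 ∈ E k, {w | w e < t k e} with hV
    have hUm : MeasurableSet U := MeasurableSet.iUnion fun e =>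
      measurableSet_lt (measurable_pi_apply e) measurable_const
    have hVm : MeasurableSet V := I.measurableSet_biInter fun k _ => MeasurableSet.iUnion fun e =>
      MeasurableSet.iUnion fun _ => measurableSet_lt (measurable_pi_apply e) measurable_const
    have hUeq : {ω | ∃ e ∈ E a, X e ω < t a e} = (fun ω (i : E a) => X i ω) ⁻¹' U := by
      ext ω; simp [hU]
    have hVeq : {ω | ∀ k ∈ I, ∃ e ∈ E k, X e ω < t k e} = (fun ω (i : T) => X i ω) ⁻¹' V := by
      ext ω
      simp only [hV, hT, Set.mem_ofPred_eq, Set.mem_preimage, Set.mem_iInter, Set.mem_iUnion,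
        exists_prop, Subtype.exists]
      refine forall₂_congr fun k hk => exists_congr fun e => ?_
      exact ⟨fun h => ⟨Finset.mem_biUnion.2 ⟨k, hk, h.1⟩, h⟩, fun h => h.2⟩
    have hsplit : {ω | ∀ k ∈ insert a I, ∃ e ∈ E k, X e ω < t k e} =
        {ω | ∃ e ∈ E a, X e ω < t a e} ∩ {ω | ∀ k ∈ I, ∃ e ∈ E k, X e ω < t k e} := by
      ext ω; simp
    have hprod : μ.real {ω | ∃ e ∈ E a, X e ω < t a e} =
        1 - ∏ e ∈ E a, μ.real {ω | t a e ≤ X e ω} := by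
      have hcompl : {ω | ∃ e ∈ E a, X e ω < t a e} =
          (⋂ e ∈ E a, X e ⁻¹' Set.Ici (t a e))ᶜ := by
        ext ω; simp
      have hnull : NullMeasurableSet (⋂ e ∈ E a, X e ⁻¹' Set.Ici (t a e)) μ :=
        Finset.nullMeasurableSet_biInter _ fun e _ =>
          (hm e).nullMeasurableSet_preimage measurableSet_Ici
      rw [hcompl, measureReal_compl₀ hnull, probReal_univ]
      congr 1
      rw [measureReal_def, hX.measure_inter_preimage_eq_mul (E a) fun _ _ => measurableSet_Ici,
        ENNReal.toReal_prod]
      rfl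
    rw [hsplit, hUeq, hVeq, measureReal_def, hind.measure_inter_preimage_eq_mul _ _ hUm hVm,
      ENNReal.toReal_mul, ← hUeq, ← hVeq, ← measureReal_def, ← measureReal_def, hprod,
      Finset.card_insert_of_notMem ha, pow_succ']
    have hpa := hp a (Finset.mem_insert_self _ _)
    have hle : 0 ≤ 1 - ∏ e ∈ E a, μ.real {ω | t a e ≤ X e ω} := hprod ▸ measureReal_nonneg
    exact mul_le_mul (by linarith) hih measureReal_nonneg (by linarith)

/-- Conditioning on a finitely valued variable `A` independent of `Y`: a bound on the probability of
`Y ∈ F G` for each admissible value `G` of `A` bounds that of `Y ∈ F A`. The set `D` need not be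
measurable. -/
lemma measureReal_le_of_indepFun {Ω 𝒢 β : Type*} [MeasurableSpace Ω] [Finite 𝒢]
    [MeasurableSpace 𝒢] [MeasurableSingletonClass 𝒢] [MeasurableSpace β]
    {μ : Measure Ω} [IsProbabilityMeasure μ] {A : Ω → 𝒢} {Y : Ω → β} (hA : AEMeasurable A μ)
    (hAY : IndepFun A Y μ) {s : Set 𝒢} (hs : ∀ᵐ ω ∂μ, A ω ∈ s) {F : 𝒢 → Set β}
    (hF : ∀ G ∈ s, MeasurableSet (F G)) {q : ℝ} (hq : ∀ G ∈ s, μ.real (Y ⁻¹' F G) ≤ q)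
    (hq0 : 0 ≤ q) {D : Set Ω} (hD : ∀ ω ∈ D, A ω ∈ s → Y ω ∈ F (A ω)) : μ.real D ≤ q := by
  classical
  have := Fintype.ofFinite 𝒢
  have hsub : μ.real D ≤
      μ.real (⋃ G ∈ Finset.univ.filter (· ∈ s), A ⁻¹' {G} ∩ Y ⁻¹' F G) := by
    refine ENNReal.toReal_mono (measure_ne_top _ _) (measure_mono_ae ?_)
    filter_upwards [hs] with ω hω hωD
    exact Set.mem_biUnion (by simpa using hω) ⟨rfl, hD ω hωD hω⟩
  have hprob : IsProbabilityMeasure (μ.map A) := Measure.isProbabilityMeasure_map hA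
  have hpre : ∀ G, μ.real (A ⁻¹' {G}) = (μ.map A).real {G} := fun G => by
    rw [map_measureReal_apply_of_aemeasurable hA (measurableSet_singleton G)]
  calc μ.real D ≤ _ := hsub
    _ ≤ ∑ G with G ∈ s, μ.real (A ⁻¹' {G} ∩ Y ⁻¹' F G) := measureReal_biUnion_finset_le _ _
    _ ≤ ∑ G with G ∈ s, (μ.map A).real {G} * q := by
        refine Finset.sum_le_sum fun G hG => ?_
        have hG' : G ∈ s := by simpa using hG
        rw [measureReal_def, hAY.measure_inter_preimage_eq_mul _ _ (measurableSet_singleton G)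
          (hF G hG'), ENNReal.toReal_mul, ← measureReal_def, ← measureReal_def, hpre]
        exact mul_le_mul_of_nonneg_left (hq G hG') measureReal_nonneg
    _ ≤ ∑ G, (μ.map A).real {G} * q :=
        Finset.sum_le_sum_of_subset_of_nonneg (Finset.filter_subset _ _) fun _ _ _ =>
          mul_nonneg measureReal_nonneg hq0
    _ = q := by
        rw [← Finset.sum_mul, sum_measureReal_singleton, Finset.coe_univ, probReal_univ, one_mul]

instance {V : Type*} [Countable V] : MeasurableSingletonClass (SimpleGraph V) where
  measurableSet_singleton G := by
    have : ({G} : Set (SimpleGraph V)) = {H | ∀ u v, H.Adj u v = G.Adj u v} := by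
      ext H
      simp only [Set.mem_singleton_iff, Set.mem_ofPred_eq]
      refine ⟨by rintro rfl; simp, fun h => SimpleGraph.ext ?_⟩
      funext u v; exact h u v
    rw [this]
    simp only [Set.ofPred_forall]
    exact MeasurableSet.iInter fun u => MeasurableSet.iInter fun v =>
      measurableSet_eq_fun (by fun_prop) measurable_const

/-- The tail bound extended from `t ≥ 1` to all `t ≥ 0`, at the price of a smaller constant. -/
lemma IsWeibull.le_measureReal_Ici {α C₁ C₂ : ℝ} {ν : Measure ℝ} (h : IsWeibull α C₁ C₂ ν)
    {t : ℝ} (ht : 0 ≤ t) :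
    C₁ / (2 * Real.exp 1) * Real.exp (-t ^ α) ≤ ν.real (Set.Ici t) := by
  have := h.isProb
  have hC := h.pos₁
  rcases le_total 1 t with h1 | h1
  · refine le_trans ?_ (h.right_lower t h1)
    rw [mul_div_right_comm]
    gcongr
    have : 1 ≤ Real.exp 1 := Real.one_le_exp zero_le_one
    linarith
  · calc C₁ / (2 * Real.exp 1) * Real.exp (-t ^ α) ≤ C₁ / (2 * Real.exp 1) * 1 := by
          gcongr
          exact Real.exp_le_one_iff.2 (neg_nonpos.2 (Real.rpow_nonneg ht _))
      _ = C₁ * Real.exp (-1 ^ α) / 2 := by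
          rw [Real.one_rpow, Real.exp_neg]; field_simp
      _ ≤ ν.real (Set.Ici 1) := h.right_lower 1 le_rfl
      _ ≤ ν.real (Set.Ici t) := measureReal_mono (Set.Ici_subset_Ici.2 h1)

/-- If in every regular graph each ball of radius `L` carries at most `N` thresholds of total cost `B`
which force the largest eigenvalue above `r`, then the balls of a packing are independent attempts
to exceed `r`. -/
lemma prob_largestEigenvalue_le {Ω : Type*} [MeasurableSpace Ω] {μ : Measure Ω}
    [IsProbabilityMeasure μ] {n d L N : ℕ} {α C₁ C₂ r B : ℝ} (hα : 0 < α)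
    {A : Ω → SimpleGraph (Fin n)} {W : Ω → Matrix (Fin n) (Fin n) ℝ}
    (h : IsWeightedRegularGraph μ n d α C₁ C₂ A W)
    (hforce : ∀ G ∈ regularGraphs n d, ∀ x, ∃ (S : Finset (UpperPair n)) (t : UpperPair n → ℝ),
      (∀ e ∈ S, e.1.1 ∈ walkBall G L x) ∧ S.card ≤ N ∧ (∀ e ∈ S, 0 ≤ t e) ∧
      ∑ e ∈ S, t e ^ α ≤ B ∧ ∀ W : Matrix (Fin n) (Fin n) ℝ, W.IsSymm →
        (∀ e ∈ S, t e ≤ W e.1.1 e.1.2) → r < largestEigenvalue (weightedAdj G W)) :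
    μ.real {ω | largestEigenvalue (weightedAdj (A ω) (W ω)) ≤ r} ≤
      Real.exp (-((C₁ / (2 * Real.exp 1)) ^ N * Real.exp (-B) *
        (n / ((d + 1) ^ L * (d + 1) ^ L)))) := by
  classical
  obtain ⟨ν, hν, hlaw⟩ := h.weight_law
  have := hν.isProb
  set c := C₁ / (2 * Real.exp 1) with hc
  have hc0 : 0 < c := by have := hν.pos₁; positivity
  have hc1 : c ≤ 1 := by
    have := hν.le_measureReal_Ici le_rfl
    rw [Real.zero_rpow hα.ne', neg_zero, Real.exp_zero, mul_one] at this
    exact this.trans measureReal_le_one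
  set X : UpperPair n → Ω → ℝ := fun e ω => W ω e.1.1 e.1.2
  have hXm : ∀ e, AEMeasurable (X e) μ := fun e => (hlaw _ _ e.2).aemeasurable
  have hXp : ∀ e t, μ.real {ω | t ≤ X e ω} = ν.real (Set.Ici t) := fun e t =>
    (hlaw _ _ e.2).measureReal_eq (p := fun x => t ≤ x) measurableSet_Ici
  have hs : ∀ᵐ ω ∂μ, A ω ∈ regularGraphs n d := by
    have hms : MeasurableSet (regularGraphs n d) := (Set.toFinite _).measurableSet
    have := (h.graph_law.ae_iff (p := (· ∈ regularGraphs n d)) hms.mem).2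
    exact this (ae_cond_mem hms)
  choose! S t hSball hSN ht0 htB hS using hforce
  choose! I hI hIcard using fun G (hG : G ∈ regularGraphs n d) =>
    exists_pairwiseDisjoint_walkBall (G := G) hG L
  refine measureReal_le_of_indepFun h.graph_law.aemeasurable h.graph_indep hs
    (F := fun G => ⋂ x ∈ I G, ⋃ e ∈ S G x, {w | w e < t G x e}) (fun G _ => ?_) (fun G hG => ?_)
    (Real.exp_nonneg _) fun ω hω hA => ?_
  · exact (I G).measurableSet_biInter fun x _ => (S G x).measurableSet_biUnion fun e _ =>
      measurableSet_lt (measurable_pi_apply e) measurable_const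
  · set p := c ^ N * Real.exp (-B) with hp
    have hset : (fun ω (e : UpperPair n) => W ω e.1.1 e.1.2) ⁻¹'
        (⋂ x ∈ I G, ⋃ e ∈ S G x, {w | w e < t G x e}) =
        {ω | ∀ x ∈ I G, ∃ e ∈ S G x, X e ω < t G x e} := by
      ext ω; simp [X]
    have hdisj : (I G : Set (Fin n)).PairwiseDisjoint (S G) := fun x hx y hy hxy =>
      Finset.disjoint_left.2 fun e he he' => Finset.disjoint_left.1 (hI G hG hx hy hxy)
        (hSball G hG x e he) (hSball G hG y e he')
    have hprod : ∀ x ∈ I G, p ≤ ∏ e ∈ S G x, μ.real {ω | t G x e ≤ X e ω} := fun x _ =>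
      calc p ≤ c ^ (S G x).card * Real.exp (-∑ e ∈ S G x, t G x e ^ α) := by
            rw [hp]
            gcongr ?_ * Real.exp (-?_)
            · exact pow_le_pow_of_le_one hc0.le hc1 (hSN G hG x)
            · exact htB G hG x
        _ = ∏ e ∈ S G x, c * Real.exp (-t G x e ^ α) := by
            rw [Finset.prod_mul_distrib, Finset.prod_const, ← Real.exp_sum,
              Finset.sum_neg_distrib]
        _ ≤ _ := Finset.prod_le_prod (fun _ _ => by positivity) fun e he => by
            rw [hXp]; exact hν.le_measureReal_Ici (ht0 G hG x e he)
    rw [hset]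
    have hmain := iIndepFun.measureReal_forall_exists_lt_le h.weight_indep hXm (I G) hdisj hprod
    -- The bound `p ≤ 1` is only available when there is at least one ball.
    have hp1 : 0 ≤ 1 - p ∨ (I G).card = 0 := by
      rcases (I G).eq_empty_or_nonempty with h0 | ⟨x, hx⟩
      · exact Or.inr (by simp [h0])
      · refine Or.inl (sub_nonneg.2 ((hprod x hx).trans ?_))
        exact Finset.prod_le_one (fun _ _ => measureReal_nonneg) fun _ _ => measureReal_le_one
    have hcard : (n : ℝ) / ((d + 1) ^ L * (d + 1) ^ L) ≤ (I G).card := by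
      rw [div_le_iff₀ (by positivity)]
      have := hIcard G hG
      rw [Fintype.card_fin] at this
      exact_mod_cast this
    refine hmain.trans ?_
    calc (1 - p) ^ (I G).card ≤ Real.exp (-p) ^ (I G).card := by
          rcases hp1 with hp1 | h0
          · exact pow_le_pow_left₀ hp1 (Real.one_sub_le_exp_neg p) _
          · simp [h0]
      _ = Real.exp (-(p * (I G).card)) := by rw [← Real.exp_nat_mul]; ring_nf
      _ ≤ _ := by gcongr
  · simp only [Set.mem_iInter, Set.mem_iUnion, Set.mem_ofPred_eq, exists_prop]
    intro x _
    by_contra! hcon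
    exact (hS (A ω) hA x (W ω) (h.symm ω) hcon).not_ge hω

end Probability

/-! ### Asymptotics in the number of vertices -/

/-- With the budget `s * log n` the failure probability is `exp (-c * n ^ (1 - s))`; a larger exponent
`κ > s` absorbs the constant `c`. -/
lemma eventually_prob_largestEigenvalue_le {α s κ : ℝ} (hα : 0 < α) (hs : s < κ) {d L N : ℕ}
    (C₁ C₂ : ℝ) {r : ℕ → ℝ}
    (hforce : ∀ᶠ n : ℕ in atTop, ∀ G ∈ regularGraphs n d, ∀ x,
      ∃ (S : Finset (UpperPair n)) (t : UpperPair n → ℝ),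
      (∀ e ∈ S, e.1.1 ∈ walkBall G L x) ∧ S.card ≤ N ∧ (∀ e ∈ S, 0 ≤ t e) ∧
      ∑ e ∈ S, t e ^ α ≤ s * Real.log n ∧ ∀ W : Matrix (Fin n) (Fin n) ℝ, W.IsSymm →
        (∀ e ∈ S, t e ≤ W e.1.1 e.1.2) → r n < largestEigenvalue (weightedAdj G W)) :
    ∀ᶠ n : ℕ in atTop,
      ∀ (Ω : Type*) [MeasurableSpace Ω] (μ : Measure Ω) [IsProbabilityMeasure μ]
        (A : Ω → SimpleGraph (Fin n)) (W : Ω → Matrix (Fin n) (Fin n) ℝ),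
        IsWeightedRegularGraph μ n d α C₁ C₂ A W →
        μ.real {ω | largestEigenvalue (weightedAdj (A ω) (W ω)) ≤ r n} ≤
          Real.exp (-((n : ℝ) ^ (1 - κ))) := by
  by_cases hC : 0 < C₁
  swap
  · refine Eventually.of_forall fun n Ω _ μ _ A W h => ?_
    obtain ⟨ν, hν, -⟩ := h.weight_law
    exact absurd hν.pos₁ hC
  set c := (C₁ / (2 * Real.exp 1)) ^ N / (((d : ℝ) + 1) ^ L * (d + 1) ^ L) with hc
  have hc0 : 0 < c := by positivity
  filter_upwards [hforce, eventually_gt_atTop 0,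
    eventually_rpow_le_const_mul_rpow hc0 (sub_lt_sub_left hs 1)] with n hn hn0 hpow Ω _ μ _ A W h
  have hn' : (0 : ℝ) < n := by exact_mod_cast hn0
  refine (prob_largestEigenvalue_le hα h hn).trans (Real.exp_le_exp.2 (neg_le_neg ?_))
  refine hpow.trans (le_of_eq ?_)
  rw [show -(s * Real.log n) = Real.log n * -s by ring, ← Real.rpow_def_of_pos hn',
    sub_eq_add_neg, Real.rpow_add hn', Real.rpow_one, hc]
  ring

theorem proposition2p3 :
    (∀ α β : ℝ, 1 < α → 1 / α + 1 / β = 1 →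
      ∃ δ₀ : ℝ, 0 < δ₀ ∧ δ₀ ≤ 1 ∧ ∀ δ : ℝ, 0 < δ → δ < δ₀ →
      ∀ d L : ℕ, 3 ≤ d → 1 ≤ L → ∀ C₁ C₂ : ℝ,
      ∃ ε : ℕ → ℝ, Tendsto ε atTop (𝓝 0) ∧ ∀ᶠ n : ℕ in atTop,
        ∀ (Ω : Type*) [MeasurableSpace Ω] (μ : Measure Ω) [IsProbabilityMeasure μ]
          (A : Ω → SimpleGraph (Fin n)) (W : Ω → Matrix (Fin n) (Fin n) ℝ),
          IsWeightedRegularGraph μ n d α C₁ C₂ A W →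
          μ.real {ω | largestEigenvalue (weightedAdj (A ω) (W ω)) ≤
              (1 - δ) * (2 : ℝ) ^ (1 / α) * treeConst d L (β / 2) *
                Real.log n ^ (1 / α)} ≤
            Real.exp (-((n : ℝ) ^ (1 - (1 - δ) ^ α + ε n)))) ∧
    (∀ α : ℝ, 0 < α → α ≤ 1 → ∀ δ : ℝ, 0 < δ → δ < 1 →
      ∀ d : ℕ, 3 ≤ d → ∀ C₁ C₂ : ℝ,
      ∃ ε : ℕ → ℝ, Tendsto ε atTop (𝓝 0) ∧ ∀ᶠ n : ℕ in atTop,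
        ∀ (Ω : Type*) [MeasurableSpace Ω] (μ : Measure Ω) [IsProbabilityMeasure μ]
          (A : Ω → SimpleGraph (Fin n)) (W : Ω → Matrix (Fin n) (Fin n) ℝ),
          IsWeightedRegularGraph μ n d α C₁ C₂ A W →
          μ.real {ω | largestEigenvalue (weightedAdj (A ω) (W ω)) ≤
              (1 - δ) * Real.log n ^ (1 / α)} ≤
            Real.exp (-((n : ℝ) ^ (1 - (1 - δ) ^ α + ε n)))) := by
  have hlog : ∀ᶠ n : ℕ in atTop, 0 < Real.log n := by
    filter_upwards [eventually_gt_atTop 1] with n hn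
    exact Real.log_pos (by exact_mod_cast hn)
  -- Spending slightly more than `(1 - δ) ^ α * log n` buys a factor slightly above `1 - δ`.
  have hroot : ∀ {α δ η : ℝ}, 0 < α → δ < 1 → 0 < η →
      0 < (1 - δ) ^ α + η / 2 ∧ 1 - δ < ((1 - δ) ^ α + η / 2) ^ (1 / α) := by
    intro α δ η hα hδ hη
    have h0 : 0 < 1 - δ := by linarith
    have hpos : 0 < (1 - δ) ^ α := Real.rpow_pos_of_pos h0 α
    refine ⟨by linarith, ?_⟩
    calc 1 - δ = ((1 - δ) ^ α) ^ (1 / α) := by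
          rw [← Real.rpow_mul h0.le, mul_one_div_cancel hα.ne', Real.rpow_one]
      _ < _ := Real.rpow_lt_rpow hpos.le (by linarith) (by positivity)
  constructor
  · intro α β hα hαβ
    refine ⟨1, one_pos, le_rfl, fun δ hδ0 hδ1 d L hd hL C₁ C₂ => ?_⟩
    have hα0 : 0 < α := by linarith
    have hβ1 : 1 < β := (Real.holderConjugate_iff.2 ⟨hα, by simpa using hαβ⟩).symm.lt
    refine exists_tendsto_zero_of_forall_eventually (P := fun n ε =>
      ∀ (Ω : Type _) [MeasurableSpace Ω] (μ : Measure Ω) [IsProbabilityMeasure μ]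
        (A : Ω → SimpleGraph (Fin n)) (W : Ω → Matrix (Fin n) (Fin n) ℝ),
        IsWeightedRegularGraph μ n d α C₁ C₂ A W →
        μ.real {ω | largestEigenvalue (weightedAdj (A ω) (W ω)) ≤
          (1 - δ) * (2 : ℝ) ^ (1 / α) * treeConst d L (β / 2) * Real.log n ^ (1 / α)} ≤
          Real.exp (-((n : ℝ) ^ (1 - (1 - δ) ^ α + ε)))) fun η hη => ?_
    simp only [show 1 - (1 - δ) ^ α + -η = 1 - ((1 - δ) ^ α + η) by ring]
    obtain ⟨hs0, hsδ⟩ := hroot (δ := δ) hα0 hδ1 hη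
    set s := (1 - δ) ^ α + η / 2
    -- A near-maximizer is enough, so that the supremum need not be attained.
    have hK := treeConst_pos (d := d) (by omega) hL (by linarith : 0 < β / 2)
    have hsα : 0 < s ^ (1 / α) := Real.rpow_pos_of_pos hs0 _
    obtain ⟨u, hu, hsum, hM⟩ := exists_lt_edgeEnergy_rpow (d := d) (L := L) (γ := β / 2)
      (b := (1 - δ) * treeConst d L (β / 2) / s ^ (1 / α)) (by
        rw [div_lt_iff₀ hsα, mul_comm]; exact mul_lt_mul_of_pos_left hsδ hK)
    rw [show 1 / (2 * (β / 2)) = 1 / β by congr 1; ring] at hM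
    set E := edgeEnergy (regularTree d L) (β / 2) u
    have hM0 : 0 < E ^ (1 / β) :=
      (div_nonneg (mul_nonneg (by linarith) hK.le) hsα.le).trans_lt hM
    have hE : 0 < E := by
      refine (edgeEnergy_nonneg _ _ hu).lt_of_ne fun h0 => ?_
      have hβ : 1 / β ≠ 0 := (one_div_pos.2 (by linarith)).ne'
      rw [show E = 0 from h0.symm, Real.zero_rpow hβ] at hM0
      exact lt_irrefl _ hM0
    refine eventually_prob_largestEigenvalue_le (L := L)
      (N := Fintype.card (TreeVertex d L) ^ 2) (s := s) hα0
      (show s < (1 - δ) ^ α + η by simp only [s]; linarith) C₁ C₂ ?_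
    filter_upwards [hlog] with n hn G hG x
    classical
    obtain ⟨π, hball, hom, inj⟩ := exists_regularTree_cover hG L x
    have hpush : E ≤ _ := edgeEnergy_le_edgeEnergy_pushforward hom inj
      (show 1 / 2 ≤ β / 2 by linarith) hu
    obtain ⟨S, t, hSR, hcard, ht0, htB, hW⟩ := exists_thresholds G hα hαβ (mul_pos hs0 hn)
      (u := massPushforward π u) (R := Finset.univ.image π)
      (massPushforward_nonneg π hu) ((sum_massPushforward π u).trans hsum)
      (fun z hz => massPushforward_eq_zero u fun y hy =>
        hz (hy ▸ Finset.mem_image_of_mem _ (Finset.mem_univ y)))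
      (hE.trans_le hpush)
    refine ⟨S, t, fun e he => ?_, hcard.trans ?_, ht0, htB, fun W hsymm hWt => ?_⟩
    · obtain ⟨w, -, hw⟩ := Finset.mem_image.1 (hSR e he)
      exact hw ▸ hball w
    · exact Nat.pow_le_pow_left Finset.card_image_le 2
    · refine lt_of_lt_of_le ?_ (hW W hsymm hWt)
      calc (1 - δ) * 2 ^ (1 / α) * treeConst d L (β / 2) * Real.log n ^ (1 / α)
          < 2 ^ (1 / α) * E ^ (1 / β) * (s ^ (1 / α) * Real.log n ^ (1 / α)) := by
            rw [div_lt_iff₀ hsα] at hM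
            have := mul_lt_mul_of_pos_left hM (show 0 < (2 : ℝ) ^ (1 / α) *
              Real.log n ^ (1 / α) by positivity)
            linarith
        _ = 2 ^ (1 / α) * E ^ (1 / β) * (s * Real.log n) ^ (1 / α) := by
            rw [Real.mul_rpow hs0.le hn.le]
        _ ≤ _ := by gcongr
  · intro α hα _ δ hδ0 hδ1 d hd C₁ C₂
    refine exists_tendsto_zero_of_forall_eventually (P := fun n ε =>
      ∀ (Ω : Type _) [MeasurableSpace Ω] (μ : Measure Ω) [IsProbabilityMeasure μ]
        (A : Ω → SimpleGraph (Fin n)) (W : Ω → Matrix (Fin n) (Fin n) ℝ),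
        IsWeightedRegularGraph μ n d α C₁ C₂ A W →
        μ.real {ω | largestEigenvalue (weightedAdj (A ω) (W ω)) ≤
          (1 - δ) * Real.log n ^ (1 / α)} ≤
          Real.exp (-((n : ℝ) ^ (1 - (1 - δ) ^ α + ε)))) fun η hη => ?_
    simp only [show 1 - (1 - δ) ^ α + -η = 1 - ((1 - δ) ^ α + η) by ring]
    obtain ⟨hs0, hsδ⟩ := hroot (δ := δ) hα hδ1 hη
    set s := (1 - δ) ^ α + η / 2
    refine eventually_prob_largestEigenvalue_le (L := 1) (N := 1) (s := s) hα
      (show s < (1 - δ) ^ α + η by simp only [s]; linarith) C₁ C₂ ?_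
    filter_upwards [hlog] with n hn G hG x
    obtain ⟨σ, -, hadj, -⟩ := exists_neighbor_labelling hG x
    -- One edge at `x`, listed with its smaller end first.
    obtain ⟨e, he, hex⟩ : ∃ e : UpperPair n, G.Adj e.1.1 e.1.2 ∧ e.1.1 ∈ walkBall G 1 x := by
      have h := hadj ⟨0, by omega⟩
      rcases lt_or_gt_of_ne h.ne with hlt | hlt
      · exact ⟨⟨(x, _), hlt⟩, h, mem_walkBall_self _ _⟩
      · exact ⟨⟨(_, x), hlt⟩, h.symm,
          mem_walkBall_succ.2 ⟨x, mem_walkBall_self _ _, Or.inr h⟩⟩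
    refine ⟨{e}, fun _ => (s * Real.log n) ^ (1 / α), by simpa using hex, by simp,
      fun _ _ => by positivity, ?_, fun W hsymm hWt => ?_⟩
    · rw [Finset.sum_singleton, ← Real.rpow_mul (by positivity), one_div_mul_cancel hα.ne',
        Real.rpow_one]
    · refine lt_of_lt_of_le ?_ ((hWt e (Finset.mem_singleton_self e)).trans
        (le_largestEigenvalue_of_adj hsymm he))
      rw [Real.mul_rpow hs0.le hn.le]
      exact mul_lt_mul_of_pos_right hsδ (by positivity)
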